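/- Let $q=p^r$ be an odd prime power ($p$ prime) of the form $q=6f+1$ with $f$ even, and let $\alpha$ be a primitive element of $\mathrm{GF}(q)$. For $e\mid q-1$ write $C_i^e=\alpha^i\langle\alpha^e\rangle$, and let ${C_0^2}'=\{C_0^6,C_2^6,C_4^6\}$, a partition of the set $C_0^2$ of nonzero squares. There is a unique integer $s$ for which some integer $t$ satisfies $$q=s^2+3t^2,\qquad s\equiv 1 \pmod 3,$$ where $t=0$ is required if $p\equiv 5\pmod 6$ (so $r$ is even and $s=\pm p^{r/2}$), and $\gcd(s,t)=1$ is required if $p\equiv 1\pmod 6$. Let $s$ be this integer. For a finite additive group $G$ of order $n$, put $G^*=G\setminus\{0\}$, and let $D_1,\dots,D_m$ be pairwise disjoint $k$-subsets of $G$ with union $S$. If all $D_i\subseteq G^*$, the family is an $(n,m,k,\lambda,\mu)$-DPDF (disjoint partial difference family) if the multiset of all differences $x-y$ with $x\ne y$ in the same $D_i$ contains each element of $S$ exactly $\lambda$ times, each element of $G^*\setminus S$ exactly $\mu$ times, and nothing else. It is an $(n,m,k,\lambda,\mu)$-EPDF (external partial difference family) if the same holds for the multiset of all differences $x-y$ with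 $x\in D_i$, $y\in D_j$, $i\neq j$. Either is proper if $\lambda\neq\mu$. An $(n,m,k,\lambda)$-EDF (external difference family) is a family of pairwise disjoint $k$-subsets $D_1,\dots,D_m$ of $G$ for which the latter multiset contains each element of $G^*$ exactly $\lambda$ times and nothing else. Then, in the additive group of $\mathrm{GF}(q)$: (i) if $s\ne 1$, ${C_0^2}'$ is a proper $\left(q,3,\frac{q-1}{6},\frac{q-9-4s}{12},\frac{q-5+4s}{12}\right)$-DPDF and a proper $\left(q,3,\frac{q-1}{6},\frac{q-3+2s}{6},\frac{q+1-2s}{6}\right)$-EPDF; (ii) if $s=1$, ${C_0^2}'$ is a proper $\left(q,3,\frac{q-1}{6},\frac{q-13}{12},\frac{q-1}{12}\right)$-DPDF and a $\left(q,3,\frac{q-1}{6},\frac{q-1}{6}\right)$-EDF. -/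

import Mathlib

namespace DiffFamily

section Families

variable {G : Type*} [AddGroup G] [DecidableEq G]

/-- The multiset `Δ(D)` of internal differences `x - y` with `x ≠ y` in `D`. -/
def intDiff (D : Finset G) : Multiset G :=
  D.offDiag.val.map fun z => z.1 - z.2

/-- The multiset `Δ(A, B)` of differences `x - y` with `x ∈ A` and `y ∈ B`. -/
def extDiff (A B : Finset G) : Multiset G :=
  (A ×ˢ B).val.map fun z => z.1 - z.2

/-- The multiset union (with multiplicities) of all `Δ(D i)`. -/
def allInt {m : ℕ} (D : Fin m → Finset G) : Multiset G :=
  ∑ i, intDiff (D i)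

/-- The multiset union (with multiplicities) of all `Δ(D i, D j)` with `i ≠ j`. -/
def allExt {m : ℕ} (D : Fin m → Finset G) : Multiset G :=
  ∑ z ∈ (Finset.univ : Finset (Fin m)).offDiag, extDiff (D z.1) (D z.2)

variable [Fintype G]

/-- The nonzero elements of `G`. -/
def nonzero (G : Type*) [AddGroup G] [DecidableEq G] [Fintype G] : Finset G :=
  Finset.univ.erase 0

/-- The union of the members of a family. -/
def support {m : ℕ} (D : Fin m → Finset G) : Finset G :=
  Finset.univ.biUnion D

/-- `m` pairwise disjoint `k`-subsets of a group `G` of order `n`. -/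
def IsDisjointFamily (n m k : ℕ) (D : Fin m → Finset G) : Prop :=
  Fintype.card G = n ∧ (∀ i, (D i).card = k) ∧ Pairwise fun i j => Disjoint (D i) (D j)

/-- An `(n, m, k, lam)`-external difference family of `G`. -/
def IsEDF (n m k lam : ℕ) (D : Fin m → Finset G) : Prop :=
  IsDisjointFamily n m k D ∧ allExt D = lam • (nonzero G).val

/-- An `(n, m, k, lam, mu)`-disjoint partial difference family of `G`. -/
def IsDPDF (n m k lam mu : ℕ) (D : Fin m → Finset G) : Prop :=
  IsDisjointFamily n m k D ∧ (∀ i, (0 : G) ∉ D i) ∧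
    allInt D = lam • (support D).val + mu • (nonzero G \ support D).val

/-- An `(n, m, k, lam, mu)`-external partial difference family of `G`. -/
def IsEPDF (n m k lam mu : ℕ) (D : Fin m → Finset G) : Prop :=
  IsDisjointFamily n m k D ∧ (∀ i, (0 : G) ∉ D i) ∧
    allExt D = lam • (support D).val + mu • (nonzero G \ support D).val

/-- A proper disjoint partial difference family. -/
def IsProperDPDF (n m k lam mu : ℕ) (D : Fin m → Finset G) : Prop :=
  IsDPDF n m k lam mu D ∧ lam ≠ mu

/-- A proper external partial difference family. -/
def IsProperEPDF (n m k lam mu : ℕ) (D : Fin m → Finset G) : Prop :=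
  IsEPDF n m k lam mu D ∧ lam ≠ mu

end Families

section Cyclotomy

variable {F : Type*} [Field F] [Fintype F]

open scoped Classical in
/-- The cyclotomic class `C_i^e = α ^ i ⟨α ^ e⟩`, as a subset of the field. -/
noncomputable def cyclotomicClass (α : Fˣ) (e i : ℕ) : Finset F :=
  Finset.univ.filter fun x : F => ∃ u ∈ Subgroup.zpowers (α ^ e), x = ((α ^ i * u : Fˣ) : F)

/-- The family `{C_0^6, C_2^6, C_4^6}` of classes of order six that partition the
nonzero squares. -/
noncomputable def squaresFamily (α : Fˣ) : Fin 3 → Finset F :=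
  fun i => cyclotomicClass α 6 (2 * (i : ℕ))

end Cyclotomy

/-- The representation `p ^ m = s ^ 2 + 3 * t ^ 2` with `s ≡ 1 (mod 3)`, where `t = 0` (so that
`m` is even and `s = ± p ^ (m / 2)`) if `p ≡ 5 (mod 6)`, and which is proper, i.e. `s` and `t`
are coprime, if `p ≡ 1 (mod 6)`. -/
def IsSexticRep (p m : ℕ) (s t : ℤ) : Prop :=
  (p : ℤ) ^ m = s ^ 2 + 3 * t ^ 2 ∧ s ≡ 1 [ZMOD 3] ∧
    (p ≡ 5 [MOD 6] → t = 0) ∧ (p ≡ 1 [MOD 6] → IsCoprime s t)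

end DiffFamily

/-! Write `η` for the quadratic character. A difference `x - y = d` with `x = u * y` means `y * (u -
1) = d`, so `y` is a nonzero square exactly when `η (u - 1) = η d`. Two nonzero squares lie in the
same class iff their quotient lies in `C_0^6`. Hence the multiplicity of `d ≠ 0` among internal
(external) differences is the number of `u` in `C_0^6` (in `C_0^2 \ C_0^6`) with `η (u - 1) = η d`
(`card_filter_sub_eq`). It depends only on `η d`, and the two values follow from the size of the set
and from `∑ η (u - 1)` over it.

The sum over `C_0^2` is `-1`. The sum over `C_0^6` reduces to `E = ∑ η (x ^ 3 + 1)`: `f` even gives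
`η (-1) = 1`, and then six times the sum is `2 * E - 2` (`sum_quadraticChar_sub_one_six`).

It remains to see that `E = -2 * s`. First and second moments of `∑ η (x ^ 3 + c)` over `c`, with a
parity argument, give `q = (E / 2) ^ 2 + 3 * t ^ 2` and the residue of `E`
(`exists_cubicSum_one_eq`). For `p ≡ 5 (mod 6)`, `t = 0` follows by descent. For `p ≡ 1 (mod 6)`,
coprimality follows because `E` is, modulo `p`, minus a binomial coefficient prime to `p`.
Uniqueness of `s` then identifies it with `-E / 2`. -/

namespace DiffFamily

/-! ### Representations of prime powers by `s ^ 2 + 3 * t ^ 2`. -/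

section Representations

lemma prime_mod_six {p : ℕ} (hp : p.Prime) (hp2 : p ≠ 2) (hp3 : p ≠ 3) :
    p ≡ 1 [MOD 6] ∨ p ≡ 5 [MOD 6] := by
  have h2 : ¬ 2 ∣ p := fun h => hp2 ((Nat.prime_dvd_prime_iff_eq Nat.prime_two hp).1 h).symm
  have h3 : ¬ 3 ∣ p := fun h => hp3 ((Nat.prime_dvd_prime_iff_eq Nat.prime_three hp).1 h).symm
  simp only [Nat.ModEq]
  omega

/-- `-3` is not a square modulo a prime `p ≡ 2 (mod 3)`. -/
lemma dvd_and_dvd_of_dvd_sq_add_three_mul_sq {p : ℕ} (hp : p.Prime) (hp5 : p ≡ 5 [MOD 6])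
    {s t : ℤ} (h : (p : ℤ) ∣ s ^ 2 + 3 * t ^ 2) : (p : ℤ) ∣ s ∧ (p : ℤ) ∣ t := by
  have : Fact p.Prime := ⟨hp⟩
  have hp6 : p % 6 = 5 := hp5
  have hpt : (p : ℤ) ∣ t := by
    by_contra ht
    have ht0 : (t : ZMod p) ≠ 0 := by rwa [Ne, ZMod.intCast_zmod_eq_zero_iff_dvd]
    have h0 : (s : ZMod p) ^ 2 + 3 * (t : ZMod p) ^ 2 = 0 := by
      have := (ZMod.intCast_zmod_eq_zero_iff_dvd _ p).2 h
      push_cast at this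
      exact this
    have h2 : (2 : ZMod p) ≠ 0 := by
      intro h2
      have h3 := (ZMod.natCast_eq_zero_iff 2 p).1 (by exact_mod_cast h2)
      have := Nat.le_of_dvd (by norm_num) h3
      omega
    have h3 : (3 : ZMod p) ≠ 0 := by
      intro h2
      have h3 := (ZMod.natCast_eq_zero_iff 3 p).1 (by exact_mod_cast h2)
      have := Nat.le_of_dvd (by norm_num) h3
      omega
    obtain ⟨r, hr⟩ : ∃ r : ZMod p, r ^ 2 = -3 := by
      refine ⟨s / t, ?_⟩
      field_simp
      linear_combination h0
    -- A square root of `-3` yields a primitive cube root of unity `(r - 1) / 2`, whose order 3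
    -- would divide `p - 1`.
    obtain ⟨w, hw⟩ : ∃ w : ZMod p, 2 * w + 1 = r := ⟨(r - 1) / 2, by field_simp; ring⟩
    have hw2 : w ^ 2 + w + 1 = 0 := by
      have h4 : (2 : ZMod p) * 2 * (w ^ 2 + w + 1) = 0 := by
        rw [← hw] at hr
        linear_combination hr
      simpa [h2] using h4
    have hw3 : w ^ 3 = 1 := by linear_combination (w - 1) * hw2
    have hw1 : w ≠ 1 := by
      rintro rfl
      apply h3
      linear_combination hw2
    have hord : orderOf w = 3 := orderOf_eq_prime hw3 hw1
    have hw0 : w ≠ 0 := by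
      rintro rfl
      norm_num at hw3
    have := ZMod.orderOf_dvd_card_sub_one hw0
    rw [hord] at this
    omega
  refine ⟨?_, hpt⟩
  have h3 : (p : ℤ) ∣ s ^ 2 :=
    (Int.dvd_add_left (Dvd.dvd.mul_left (dvd_pow hpt two_ne_zero) 3)).1 h
  exact (Nat.prime_iff_prime_int.1 hp).dvd_of_dvd_pow h3

/-- Descent: `p` divides both `s` and `t`, so `p ^ 2` cancels, until the form represents 1. -/
lemma eq_zero_of_pow_eq_sq_add_three_mul_sq {p : ℕ} (hp : p.Prime) (hp5 : p ≡ 5 [MOD 6]) :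
    ∀ (m : ℕ) {s t : ℤ}, (p : ℤ) ^ (2 * m) = s ^ 2 + 3 * t ^ 2 → t = 0
  | 0, s, t, h => by
    by_contra ht
    have := sq_nonneg s
    have := (sq_pos_iff (a := t)).2 ht
    simp at h
    omega
  | m + 1, s, t, h => by
    have hp0 : (p : ℤ) ≠ 0 := by exact_mod_cast hp.ne_zero
    obtain ⟨⟨s, rfl⟩, ⟨t, rfl⟩⟩ := dvd_and_dvd_of_dvd_sq_add_three_mul_sq hp hp5
      (s := s) (t := t) (h ▸ dvd_pow_self _ (by omega))
    have : (p : ℤ) ^ (2 * m) = s ^ 2 + 3 * t ^ 2 := by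
      apply mul_left_cancel₀ (pow_ne_zero 2 hp0)
      linear_combination h
    rw [eq_zero_of_pow_eq_sq_add_three_mul_sq hp hp5 m this, mul_zero]

/-- The product `(s t' - s' t)(s t' + s' t)` is divisible by `q = p ^ m`, and `p` cannot divide both
factors, so `q` divides one of them. The composition identity for the form then makes that factor
zero, as three times its square is at most `q ^ 2`. -/
lemma sq_eq_sq_of_rep {p m : ℕ} (hp : p.Prime) (hp2 : p ≠ 2) (hp3 : p ≠ 3) {s t s' t' : ℤ}
    (h : (p : ℤ) ^ m = s ^ 2 + 3 * t ^ 2) (h' : (p : ℤ) ^ m = s' ^ 2 + 3 * t' ^ 2)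
    (hc : IsCoprime s t) (hc' : IsCoprime s' t') : s ^ 2 = s' ^ 2 := by
  rcases Nat.eq_zero_or_pos m with rfl | hm
  · have aux : ∀ a b : ℤ, (p : ℤ) ^ 0 = a ^ 2 + 3 * b ^ 2 → a ^ 2 = 1 := by
      intro a b hab
      have := sq_nonneg a
      have := sq_nonneg b
      rw [pow_zero] at hab
      omega
    rw [aux _ _ h, aux _ _ h']
  have hP : Prime (p : ℤ) := Nat.prime_iff_prime_int.1 hp
  have key : ∀ u : ℤ, u ^ 2 = t' ^ 2 → (p : ℤ) ^ m ∣ s * u - s' * t → s ^ 2 = s' ^ 2 := by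
    intro u hu hd
    have hq : (0 : ℤ) < (p : ℤ) ^ m := pow_pos (by exact_mod_cast hp.pos) m
    have h0 : s * u - s' * t = 0 := by
      obtain ⟨k, hk⟩ := hd
      -- Brahmagupta's composition identity for `s ^ 2 + 3 * t ^ 2`, with `u = ± t'`.
      have e : ((p : ℤ) ^ m) ^ 2 = (s * s' + 3 * t * u) ^ 2 + 3 * (s * u - s' * t) ^ 2 := by
        nth_rewrite 1 [sq, h]
        rw [h']
        linear_combination (-(3 * (s ^ 2 + 3 * t ^ 2))) * hu
      have hk0 : k = 0 := by
        by_contra hk0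
        have hk1 := (sq_pos_iff (a := k)).2 hk0
        rw [hk] at e
        nlinarith [sq_nonneg (s * s' + 3 * t * u), pow_pos hq 2]
      rw [hk, hk0, mul_zero]
    have hq1 : (p : ℤ) ^ m * (s ^ 2 - s' ^ 2) = 0 := by
      have e1 : s ^ 2 * u ^ 2 = s' ^ 2 * t ^ 2 := by linear_combination (s * u + s' * t) * h0
      rw [hu] at e1
      linear_combination s ^ 2 * h' - s' ^ 2 * h + 3 * e1
    have := (mul_eq_zero.1 hq1).resolve_left hq.ne'
    linarith
  have hprod : (p : ℤ) ^ m ∣ (s * t' - s' * t) * (s * t' + s' * t) :=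
    ⟨t' ^ 2 - t ^ 2, by linear_combination t ^ 2 * h' - t' ^ 2 * h⟩
  have hndvd : ∀ a b : ℤ, (p : ℤ) ^ m = a ^ 2 + 3 * b ^ 2 → IsCoprime a b → ¬ (p : ℤ) ∣ b := by
    intro a b hab hcab hb
    have ha : (p : ℤ) ∣ a ^ 2 := by
      have h1 : (p : ℤ) ∣ a ^ 2 + 3 * b ^ 2 := hab ▸ dvd_pow_self _ hm.ne'
      exact (Int.dvd_add_left (Dvd.dvd.mul_left (dvd_pow hb two_ne_zero) 3)).1 h1
    exact hP.not_isUnit (hcab.isUnit_of_dvd' (hP.dvd_of_dvd_pow ha) hb)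
  have hor : ¬ (p : ℤ) ∣ s * t' - s' * t ∨ ¬ (p : ℤ) ∣ s * t' + s' * t := by
    by_contra! hd
    have hst : (p : ℤ) ∣ 2 * (s * t') := by
      have := dvd_add hd.2 hd.1
      convert! this using 1
      ring
    have hprime : ∀ l : ℕ, l.Prime → p ≠ l → ¬ (p : ℤ) ∣ (l : ℤ) := fun l hl hne h2 =>
      hne ((Nat.prime_dvd_prime_iff_eq hp hl).1 (by exact_mod_cast h2))
    have hs : (p : ℤ) ∣ s :=
      (hP.dvd_or_dvd ((hP.dvd_or_dvd hst).resolve_left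
        (hprime 2 Nat.prime_two hp2))).resolve_right (hndvd _ _ h' hc')
    have h3t : (p : ℤ) ∣ 3 * t ^ 2 := by
      have h1 : (p : ℤ) ∣ s ^ 2 + 3 * t ^ 2 := h ▸ dvd_pow_self _ hm.ne'
      exact (Int.dvd_add_right (dvd_pow hs two_ne_zero)).1 h1
    exact hndvd _ _ h hc (hP.dvd_of_dvd_pow
      ((hP.dvd_or_dvd h3t).resolve_left (hprime 3 Nat.prime_three hp3)))
  have hcop : ∀ x : ℤ, ¬ (p : ℤ) ∣ x → IsCoprime ((p : ℤ) ^ m) x := fun x hx =>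
    (hP.irreducible.coprime_iff_not_dvd.2 hx).pow_left
  rcases hor with hd | hd
  · refine key (-t') (neg_sq t') ?_
    have := dvd_neg.2 ((hcop _ hd).dvd_of_dvd_mul_left hprod)
    convert! this using 1
    ring
  · exact key t' rfl ((hcop _ hd).dvd_of_dvd_mul_right hprod)

/-- The integer `s` of a representation is unique. -/
lemma IsSexticRep.unique {p m : ℕ} (hp : p.Prime) (hp2 : p ≠ 2) (hp3 : p ≠ 3) {s t s' t' : ℤ}
    (h : IsSexticRep p m s t) (h' : IsSexticRep p m s' t') : s = s' := by
  obtain ⟨h1, h2, h3, h4⟩ := h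
  obtain ⟨h1', h2', h3', h4'⟩ := h'
  have hsq : s ^ 2 = s' ^ 2 := by
    rcases prime_mod_six hp hp2 hp3 with h6 | h6
    · exact sq_eq_sq_of_rep hp hp2 hp3 h1 h1' (h4 h6) (h4' h6)
    · rw [h3 h6] at h1
      rw [h3' h6] at h1'
      linarith
  rcases sq_eq_sq_iff_eq_or_eq_neg.1 hsq with h | h
  · exact h
  · rw [Int.ModEq] at h2 h2'
    omega

/-- Lucas: with `p = 6 * a + 1` and `f = p * g + a`, the last base-`p` digits of `3 * f` and `2 * f`
are `3 * a` and `2 * a`. The factor `(3 * a).choose (2 * a)` is prime to `p` since `3 * a < p`, and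
`g` plays the role of `f` for `p ^ (m - 1)`. -/
lemma not_dvd_choose_half_third {p : ℕ} (hp : p.Prime) (hp1 : p ≡ 1 [MOD 6]) :
    ∀ (m f : ℕ), p ^ m = 6 * f + 1 → ¬ p ∣ (3 * f).choose (2 * f)
  | 0, f, h => by
    obtain rfl : f = 0 := by simp at h; omega
    simpa using hp.one_lt.ne'
  | m + 1, f, h => by
    have : Fact p.Prime := ⟨hp⟩
    obtain ⟨a, ha⟩ : ∃ a, p = 6 * a + 1 := ⟨p / 6, by rw [Nat.ModEq] at hp1; omega⟩
    have hm : p ^ m ≡ 1 [MOD 6] := by simpa using hp1.pow m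
    obtain ⟨g, hg⟩ : ∃ g, p ^ m = 6 * g + 1 := ⟨p ^ m / 6, by rw [Nat.ModEq] at hm; omega⟩
    have hfg : f = p * g + a := by
      rw [pow_succ, hg] at h
      have : 6 * f = 6 * (p * g + a) := by linarith
      omega
    have hap : 3 * a < p := by omega
    have e3 : 3 * f = 3 * a + p * (3 * g) := by rw [hfg]; ring
    have e2 : 2 * f = 2 * a + p * (2 * g) := by rw [hfg]; ring
    have key := Choose.choose_modEq_choose_mod_mul_choose_div_nat (n := 3 * f) (k := 2 * f) (p := p)
    rw [e3, e2, Nat.add_mul_mod_self_left, Nat.add_mul_mod_self_left, Nat.mod_eq_of_lt hap,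
      Nat.mod_eq_of_lt (by omega : 2 * a < p), Nat.add_mul_div_left _ _ hp.pos,
      Nat.add_mul_div_left _ _ hp.pos, Nat.div_eq_of_lt hap,
      Nat.div_eq_of_lt (by omega : 2 * a < p), zero_add, zero_add] at key
    rw [e3, e2, key.dvd_iff dvd_rfl, hp.dvd_mul, not_or]
    refine ⟨fun hd => ?_, not_dvd_choose_half_third hp hp1 m g hg⟩
    have h3 : p ∣ (3 * a).factorial := by
      rw [← Nat.choose_mul_factorial_mul_factorial (by omega : 2 * a ≤ 3 * a)]
      exact (hd.mul_right _).mul_right _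
    have := (hp.dvd_factorial).1 h3
    omega

end Representations

/-! ### Cyclotomic classes as powers of a primitive element. -/

section CyclotomicClasses

lemma exists_zpow_eq {F : Type*} [Field F] {α : Fˣ} (hα : ∀ x : Fˣ, x ∈ Subgroup.zpowers α)
    {x : F} (hx : x ≠ 0) : ∃ k : ℤ, x = ((α ^ k : Fˣ) : F) := by
  obtain ⟨k, hk⟩ := hα (Units.mk0 x hx)
  exact ⟨k, by simpa using (congrArg Units.val hk).symm⟩

variable {F : Type*} [Field F] [Fintype F]

lemma orderOf_generator {α : Fˣ} (hα : ∀ x : Fˣ, x ∈ Subgroup.zpowers α) :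
    orderOf α = Fintype.card F - 1 := by
  classical
  rw [orderOf_eq_card_of_forall_mem_zpowers hα, Nat.card_eq_fintype_card, Fintype.card_units]

lemma mem_cyclotomicClass {α : Fˣ} {e i : ℕ} {x : F} :
    x ∈ cyclotomicClass α e i ↔ ∃ k : ℤ, x = ((α ^ ((i : ℤ) + e * k) : Fˣ) : F) := by
  simp only [cyclotomicClass, Finset.mem_filter, Finset.mem_univ, true_and,
    Subgroup.mem_zpowers_iff]
  constructor
  · rintro ⟨_, ⟨k, rfl⟩, rfl⟩
    exact ⟨k, by rw [zpow_add, zpow_mul, zpow_natCast, zpow_natCast]⟩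
  · rintro ⟨k, rfl⟩
    exact ⟨_, ⟨k, rfl⟩, by rw [zpow_add, zpow_mul, zpow_natCast, zpow_natCast]⟩

lemma zpow_mem_cyclotomicClass {α : Fˣ} {e i : ℕ} (he : e ∣ orderOf α) (k : ℤ) :
    ((α ^ k : Fˣ) : F) ∈ cyclotomicClass α e i ↔ (e : ℤ) ∣ k - i := by
  rw [mem_cyclotomicClass]
  constructor
  · rintro ⟨l, hl⟩
    have h := orderOf_dvd_sub_iff_zpow_eq_zpow.2 (Units.val_injective hl)
    have h' := (Int.natCast_dvd_natCast.2 he).trans h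
    have := dvd_add h' (Dvd.intro l rfl)
    convert! this using 1
    ring
  · rintro ⟨l, hl⟩
    exact ⟨l, by rw [← hl]; congr 2; ring⟩

lemma ne_zero_of_mem_cyclotomicClass {α : Fˣ} {e i : ℕ} {x : F}
    (hx : x ∈ cyclotomicClass α e i) : x ≠ 0 := by
  obtain ⟨k, rfl⟩ := mem_cyclotomicClass.1 hx
  exact Units.ne_zero _

lemma cyclotomicClass_injOn {α : Fˣ} {e n : ℕ} (i : ℕ) (hen : e * n = orderOf α) :
    Set.InjOn (fun j : ℕ => ((α ^ (i + e * j) : Fˣ) : F)) (Finset.range n) := by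
  intro a ha b hb hab
  simp only [Finset.coe_range, Set.mem_Iio] at ha hb
  have h1 : α ^ (e * a) = α ^ (e * b) := by
    have := Units.val_injective hab
    rwa [pow_add, pow_add, mul_right_inj] at this
  have he : 0 < e := by
    rcases Nat.eq_zero_or_pos e with rfl | he
    · rw [zero_mul] at hen
      exact absurd hen.symm (orderOf_pos α).ne'
    · exact he
  have h2 := pow_injOn_Iio_orderOf (x := α)
    (show e * a ∈ Set.Iio (orderOf α) by rw [← hen]; exact Nat.mul_lt_mul_of_pos_left ha he)
    (show e * b ∈ Set.Iio (orderOf α) by rw [← hen]; exact Nat.mul_lt_mul_of_pos_left hb he) h1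
  exact Nat.eq_of_mul_eq_mul_left he h2

lemma cyclotomicClass_eq_image [DecidableEq F] {α : Fˣ} {e n : ℕ} (i : ℕ)
    (hen : e * n = orderOf α) :
    cyclotomicClass α e i =
      (Finset.range n).image (fun j : ℕ => ((α ^ (i + e * j) : Fˣ) : F)) := by
  ext x
  rw [mem_cyclotomicClass, Finset.mem_image]
  have hn : 0 < n := by
    rcases Nat.eq_zero_or_pos n with rfl | he
    · rw [mul_zero] at hen
      exact absurd hen.symm (orderOf_pos α).ne'
    · exact he
  constructor
  · rintro ⟨k, rfl⟩
    have hk0 : 0 ≤ k % n := Int.emod_nonneg _ (by omega)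
    refine ⟨(k % n).toNat, ?_, ?_⟩
    · have := Int.emod_lt_of_pos k (by omega : (0 : ℤ) < n)
      rw [Finset.mem_range]
      omega
    · congr 1
      rw [← zpow_natCast, ← orderOf_dvd_sub_iff_zpow_eq_zpow, ← hen]
      refine ⟨-(k / n), ?_⟩
      push_cast
      rw [Int.toNat_of_nonneg hk0]
      have := Int.emod_add_mul_ediv k n
      linear_combination (e : ℤ) * this
  · rintro ⟨j, -, rfl⟩
    exact ⟨j, by rw [← zpow_natCast]; push_cast; rfl⟩

lemma sum_cyclotomicClass {M : Type*} [AddCommMonoid M] {α : Fˣ} {e n : ℕ} (i : ℕ)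
    (hen : e * n = orderOf α) (h : F → M) :
    ∑ x ∈ cyclotomicClass α e i, h x = ∑ j ∈ Finset.range n, h ((α ^ (i + e * j) : Fˣ) : F) := by
  classical
  rw [cyclotomicClass_eq_image i hen, Finset.sum_image (cyclotomicClass_injOn i hen)]

lemma card_cyclotomicClass {α : Fˣ} {e n : ℕ} (i : ℕ) (hen : e * n = orderOf α) :
    (cyclotomicClass α e i).card = n := by
  classical
  rw [cyclotomicClass_eq_image i hen, Finset.card_image_of_injOn (cyclotomicClass_injOn i hen),
    Finset.card_range]

lemma cyclotomicClass_one_zero [DecidableEq F] {α : Fˣ}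
    (hα : ∀ x : Fˣ, x ∈ Subgroup.zpowers α) :
    cyclotomicClass α 1 0 = (Finset.univ.erase 0 : Finset F) := by
  ext x
  simp only [Finset.mem_erase, Finset.mem_univ, and_true]
  refine ⟨ne_zero_of_mem_cyclotomicClass, fun hx => ?_⟩
  obtain ⟨k, rfl⟩ := exists_zpow_eq hα hx
  exact mem_cyclotomicClass.2 ⟨k, by simp⟩

lemma sum_erase_zero_eq_sum_range {M : Type*} [AddCommMonoid M] [DecidableEq F] {α : Fˣ}
    (hα : ∀ x : Fˣ, x ∈ Subgroup.zpowers α) (h : F → M) :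
    ∑ x ∈ Finset.univ.erase 0, h x = ∑ j ∈ Finset.range (orderOf α), h ((α ^ j : Fˣ) : F) := by
  rw [← cyclotomicClass_one_zero hα, sum_cyclotomicClass 0 (one_mul _)]
  simp

lemma sum_range_mul_of_periodic {M : Type*} [AddCommMonoid M] {h : ℕ → M} {n : ℕ}
    (hh : Function.Periodic h n) (a : ℕ) :
    ∑ j ∈ Finset.range (a * n), h j = a • ∑ j ∈ Finset.range n, h j := by
  induction a with
  | zero => simp
  | succ a ih =>
    rw [Nat.succ_mul, Finset.sum_range_add, ih, succ_nsmul]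
    congr 1
    refine Finset.sum_congr rfl fun j _ => ?_
    rw [add_comm]
    exact hh.nat_mul a j

/-- The `e`-th power map is `e` to one from the nonzero elements onto `C_0^e`. -/
lemma sum_erase_zero_pow {M : Type*} [AddCommMonoid M] [DecidableEq F] {α : Fˣ} {e n : ℕ}
    (hα : ∀ x : Fˣ, x ∈ Subgroup.zpowers α) (hen : e * n = orderOf α) (h : F → M) :
    ∑ x ∈ Finset.univ.erase 0, h (x ^ e) = e • ∑ u ∈ cyclotomicClass α e 0, h u := by
  rw [sum_erase_zero_eq_sum_range hα fun x => h (x ^ e), sum_cyclotomicClass 0 hen, ← hen,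
    sum_range_mul_of_periodic]
  · congr 1
    refine Finset.sum_congr rfl fun j _ => ?_
    rw [← Units.val_pow_eq_pow_val, ← pow_mul, zero_add, mul_comm]
  · intro j
    simp only [← Units.val_pow_eq_pow_val, ← pow_mul]
    rw [add_mul, pow_add, mul_comm n e, hen, pow_orderOf_eq_one, mul_one]

lemma pow_mem_cyclotomicClass_zero {α : Fˣ} (hα : ∀ x : Fˣ, x ∈ Subgroup.zpowers α) (e : ℕ)
    {x : F} (hx : x ≠ 0) : x ^ e ∈ cyclotomicClass α e 0 := by
  obtain ⟨k, rfl⟩ := exists_zpow_eq hα hx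
  exact mem_cyclotomicClass.2 ⟨k, by
    rw [← Units.val_pow_eq_pow_val, ← zpow_natCast, ← zpow_mul]; congr 2; push_cast; ring⟩

lemma mem_cyclotomicClass_two_iff [DecidableEq F] {α : Fˣ}
    (hα : ∀ x : Fˣ, x ∈ Subgroup.zpowers α) {x : F} :
    x ∈ cyclotomicClass α 2 0 ↔ quadraticChar F x = 1 := by
  constructor
  · intro hx
    rw [quadraticChar_one_iff_isSquare (ne_zero_of_mem_cyclotomicClass hx)]
    obtain ⟨k, rfl⟩ := mem_cyclotomicClass.1 hx
    exact ⟨((α ^ k : Fˣ) : F), by rw [← Units.val_mul, ← zpow_add]; congr 2; push_cast; ring⟩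
  · intro hx
    have hx0 : x ≠ 0 := by rintro rfl; simp at hx
    obtain ⟨y, rfl⟩ := (quadraticChar_one_iff_isSquare hx0).1 hx
    rw [← sq]
    exact pow_mem_cyclotomicClass_zero hα 2 (by rintro rfl; simp at hx0)

lemma quadraticChar_generator [DecidableEq F] {α : Fˣ}
    (hα : ∀ x : Fˣ, x ∈ Subgroup.zpowers α) (h2 : 2 ∣ orderOf α) :
    quadraticChar F (α : F) = -1 := by
  rw [quadraticChar_eq_neg_one_iff_not_one (Units.ne_zero α), ← mem_cyclotomicClass_two_iff hα]
  have := zpow_mem_cyclotomicClass (i := 0) h2 1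
  rw [zpow_one] at this
  rw [this]
  norm_num

end CyclotomicClasses

/-! ### Quadratic character sums and the cubic sum. -/

section CharacterSums

variable {F : Type*} [Field F] [Fintype F] [DecidableEq F]

/-- For `x ≠ 0`, `x * (x + d)` is a square times `1 + d / x`, and `d / x` runs over all nonzero
elements. -/
lemma sum_quadraticChar_mul_add (hF : ringChar F ≠ 2) {d : F} (hd : d ≠ 0) :
    ∑ x : F, quadraticChar F (x * (x + d)) = -1 := by
  have h1 : ∑ x : F, quadraticChar F (x * (x + d)) =
      ∑ x ∈ Finset.univ.erase 0, quadraticChar F (1 + d * x⁻¹) := by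
    rw [← Finset.add_sum_erase _ _ (Finset.mem_univ (0 : F))]
    simp only [zero_mul, MulChar.map_zero, zero_add]
    refine Finset.sum_congr rfl fun x hx => ?_
    have hx0 : x ≠ 0 := Finset.ne_of_mem_erase hx
    have : x * (x + d) = x ^ 2 * (1 + d * x⁻¹) := by field_simp
    rw [this, map_mul, quadraticChar_sq_one' hx0, one_mul]
  have h2 : ∑ x ∈ Finset.univ.erase 0, quadraticChar F (1 + d * x⁻¹) =
      ∑ y ∈ Finset.univ.erase 0, quadraticChar F (1 + y) := by
    refine Finset.sum_nbij' (fun x => d * x⁻¹) (fun y => d * y⁻¹) ?_ ?_ ?_ ?_ ?_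
    · intro x hx
      simpa [hd] using hx
    · intro x hx
      simpa [hd] using hx
    · intro x hx
      have hx0 : x ≠ 0 := Finset.ne_of_mem_erase hx
      field_simp
    · intro x hx
      have hx0 : x ≠ 0 := Finset.ne_of_mem_erase hx
      field_simp
    · intro x _
      rfl
  have h3 : ∑ y : F, quadraticChar F (1 + y) = 0 := by
    rw [← quadraticChar_sum_zero hF]
    exact Fintype.sum_equiv (Equiv.addLeft 1) _ _ fun _ => rfl
  rw [← Finset.add_sum_erase _ _ (Finset.mem_univ (0 : F)), add_zero, map_one] at h3
  rw [h1, h2]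
  linarith

lemma sum_quadraticChar_add_mul_add (hF : ringChar F ≠ 2) (a b : F) :
    ∑ c : F, quadraticChar F ((a + c) * (b + c)) =
      if a = b then (Fintype.card F : ℤ) - 1 else -1 := by
  have h1 : ∑ c : F, quadraticChar F ((a + c) * (b + c)) =
      ∑ c : F, quadraticChar F (c * (c + (b - a))) := by
    refine Fintype.sum_equiv (Equiv.addLeft a) _ _ fun c => ?_
    rw [Equiv.coe_addLeft]
    congr 1
    ring
  rw [h1]
  split_ifs with hab
  · subst hab
    rw [← Finset.add_sum_erase _ _ (Finset.mem_univ (0 : F))]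
    rw [Finset.sum_congr rfl (g := fun _ => (1 : ℤ))]
    · rw [Finset.sum_const, Finset.card_erase_of_mem (Finset.mem_univ _), Finset.card_univ]
      have := Fintype.card_pos (α := F)
      simp
      omega
    · intro x hx
      rw [sub_self, add_zero, ← sq, quadraticChar_sq_one' (Finset.ne_of_mem_erase hx)]
  · exact sum_quadraticChar_mul_add hF (sub_ne_zero.2 (Ne.symm hab))

/-- The character sum attached to the curve `y ^ 2 = x ^ 3 + c`. -/
def cubicSum (c : F) : ℤ := ∑ x : F, quadraticChar F (x ^ 3 + c)

/-- Substitute `x * d` for `x`. Up to sign, `cubicSum` thus takes only three values at nonzero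
arguments, one for each coset of the cubes. -/
lemma cubicSum_mul_cube (c : F) {d : F} (hd : d ≠ 0) :
    cubicSum (c * d ^ 3) = quadraticChar F d * cubicSum c := by
  have h3 : quadraticChar F (d ^ 3) = quadraticChar F d := by
    rw [pow_succ, map_mul, quadraticChar_sq_one' hd, one_mul]
  unfold cubicSum
  rw [← Equiv.sum_comp (Equiv.mulRight₀ d hd), Finset.mul_sum]
  refine Finset.sum_congr rfl fun x _ => ?_
  rw [← h3, ← map_mul]
  congr 1
  change (x * d) ^ 3 + c * d ^ 3 = _
  ring

lemma cubicSum_zero (hF : ringChar F ≠ 2) : cubicSum (0 : F) = 0 := by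
  rw [← quadraticChar_sum_zero hF]
  unfold cubicSum
  refine Finset.sum_congr rfl fun x _ => ?_
  rcases eq_or_ne x 0 with rfl | hx
  · simp
  · rw [add_zero, pow_succ, map_mul, quadraticChar_sq_one' hx, one_mul]

/-- First moment: after interchanging sums, `x = 0` contributes `q - 1` and every other `x`
contributes `-1`. -/
lemma sum_quadraticChar_mul_cubicSum (hF : ringChar F ≠ 2) :
    ∑ c : F, quadraticChar F c * cubicSum c = 0 := by
  simp only [cubicSum, Finset.mul_sum]
  rw [Finset.sum_comm]
  have : ∀ x : F, ∑ c : F, quadraticChar F c * quadraticChar F (x ^ 3 + c) =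
      (if x = 0 then (Fintype.card F : ℤ) else 0) - 1 := by
    intro x
    have h := sum_quadraticChar_add_mul_add hF 0 (x ^ 3)
    simp only [zero_add, map_mul] at h
    rw [h]
    by_cases hx : x = 0
    · simp [hx]
    · rw [if_neg (fun h => hx (by simpa using h.symm)), if_neg hx]
      norm_num
  simp only [this, Finset.sum_sub_distrib]
  simp

/-- The number of `x` with `x ^ 3 = y ^ 3`. -/
lemma sum_cube_eq_cube {α : Fˣ} (hα : ∀ x : Fˣ, x ∈ Subgroup.zpowers α) {n : ℕ}
    (hn : 3 * n = orderOf α) {y : F} (hy : y ≠ 0) :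
    ∑ x : F, (if x ^ 3 = y ^ 3 then (1 : ℤ) else 0) = 3 := by
  rw [← Finset.add_sum_erase _ _ (Finset.mem_univ (0 : F)),
    sum_erase_zero_pow hα hn (fun u => if u = y ^ 3 then (1 : ℤ) else 0), Finset.sum_ite_eq',
    if_pos (pow_mem_cyclotomicClass_zero hα 3 hy), if_neg]
  · norm_num
  · simpa using (pow_ne_zero 3 hy).symm

/-- Second moment: the sum over `c` of `η ((x ^ 3 + c) * (y ^ 3 + c))` is `q - 1` or `-1` according
as `x ^ 3 = y ^ 3` or not, and each `y ≠ 0` has three such `x`. -/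
lemma sum_cubicSum_sq (hF : ringChar F ≠ 2) {α : Fˣ} (hα : ∀ x : Fˣ, x ∈ Subgroup.zpowers α)
    {n : ℕ} (hn : 3 * n = orderOf α) :
    ∑ c : F, cubicSum c ^ 2 = 2 * Fintype.card F * ((Fintype.card F : ℤ) - 1) := by
  have h1 : ∀ c : F, cubicSum c ^ 2 =
      ∑ y : F, ∑ x : F, quadraticChar F ((x ^ 3 + c) * (y ^ 3 + c)) := by
    intro c
    rw [sq, cubicSum, Finset.sum_mul_sum, Finset.sum_comm]
    simp only [map_mul]
  simp only [h1]
  rw [Finset.sum_comm]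
  have h2 : ∀ y : F, ∑ c : F, ∑ x : F, quadraticChar F ((x ^ 3 + c) * (y ^ 3 + c)) =
      if y = 0 then 0 else 2 * (Fintype.card F : ℤ) := by
    intro y
    rw [Finset.sum_comm]
    have h3 : ∀ x : F, ∑ c : F, quadraticChar F ((x ^ 3 + c) * (y ^ 3 + c)) =
        Fintype.card F * (if x ^ 3 = y ^ 3 then (1 : ℤ) else 0) - 1 := by
      intro x
      rw [sum_quadraticChar_add_mul_add hF]
      split_ifs <;> ring
    simp only [h3, Finset.sum_sub_distrib, ← Finset.mul_sum]
    split_ifs with hy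
    · subst hy
      simp
    · rw [sum_cube_eq_cube hα hn hy]
      simp
      ring
  simp only [h2]
  rw [← Finset.add_sum_erase _ _ (Finset.mem_univ (0 : F)), if_pos rfl,
    Finset.sum_congr rfl (g := fun _ => 2 * (Fintype.card F : ℤ))
      (fun x hx => if_neg (Finset.ne_of_mem_erase hx)), Finset.sum_const,
    Finset.card_erase_of_mem (Finset.mem_univ _), Finset.card_univ, zero_add, nsmul_eq_mul,
    Nat.cast_sub (Fintype.card_pos (α := F))]
  push_cast
  ring

/-- Sums of functions invariant under multiplication by cubes. -/
lemma sum_eq_of_mul_cube_invariant {α : Fˣ} (hα : ∀ x : Fˣ, x ∈ Subgroup.zpowers α) {n : ℕ}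
    (hn : 3 * n = orderOf α) {h : F → ℤ} (h0 : h 0 = 0)
    (hh : ∀ c : F, h (c * (α : F) ^ 3) = h c) :
    ∑ c : F, h c = n * (h 1 + h α + h ((α : F) ^ 2)) := by
  rw [← Finset.add_sum_erase _ _ (Finset.mem_univ (0 : F)), h0, zero_add,
    sum_erase_zero_eq_sum_range hα, ← hn, mul_comm, sum_range_mul_of_periodic]
  · simp [Finset.sum_range_succ]
  · intro j
    simpa [pow_add] using hh ((α : F) ^ j)

/-- The term at `u = -1`, itself a cube, vanishes; the other `n - 1` terms, an odd number, are `±1`.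
-/
lemma odd_sum_quadraticChar_add_one {α : Fˣ} (hα : ∀ x : Fˣ, x ∈ Subgroup.zpowers α) {n : ℕ}
    (hn : 3 * n = orderOf α) (hn2 : Even n) :
    Odd (∑ u ∈ cyclotomicClass α 3 0, quadraticChar F (u + 1)) := by
  have hm1 : (-1 : F) ∈ cyclotomicClass α 3 0 := by
    have := pow_mem_cyclotomicClass_zero hα 3 (neg_ne_zero.2 (one_ne_zero' F))
    rwa [Odd.neg_one_pow (by decide)] at this
  have hpos : 0 < n := by
    have := orderOf_pos α
    omega
  have hodd : ∀ u ∈ (cyclotomicClass α 3 0).erase (-1),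
      quadraticChar F (u + 1) = 1 - 2 * if quadraticChar F (u + 1) = 1 then 0 else 1 := by
    intro u hu
    have hu0 : u + 1 ≠ 0 := fun h => Finset.ne_of_mem_erase hu (eq_neg_of_add_eq_zero_left h)
    rcases quadraticChar_dichotomy hu0 with h | h <;> rw [h] <;> norm_num
  rw [← Finset.add_sum_erase _ _ hm1, neg_add_cancel, MulChar.map_zero, zero_add,
    Finset.sum_congr rfl hodd, Finset.sum_sub_distrib, ← Finset.mul_sum, Finset.sum_const,
    Finset.card_erase_of_mem hm1, card_cyclotomicClass 0 hn, nsmul_eq_mul, mul_one]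
  refine Odd.sub_even ?_ (even_two_mul _)
  exact_mod_cast Nat.Even.sub_odd hpos hn2 odd_one

/-- `q = s ^ 2 + 3 * t ^ 2` with `s ≡ 1 (mod 3)` given by `-2 s = ∑ η (x ^ 3 + 1)`. -/
lemma exists_cubicSum_one_eq (hF : ringChar F ≠ 2) {α : Fˣ}
    (hα : ∀ x : Fˣ, x ∈ Subgroup.zpowers α) {f : ℕ} (hf : 6 * f = orderOf α) :
    ∃ s t : ℤ, cubicSum (1 : F) = -2 * s ∧ s ≡ 1 [ZMOD 3] ∧
      (Fintype.card F : ℤ) = s ^ 2 + 3 * t ^ 2 := by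
  have hn : 3 * (2 * f) = orderOf α := by omega
  have hf0 : 0 < f := by
    have := orderOf_pos α
    omega
  have hη := quadraticChar_generator hα (by omega)
  have hcube : ∀ c : F, cubicSum (c * (α : F) ^ 3) = -cubicSum c := fun c => by
    rw [cubicSum_mul_cube c (Units.ne_zero α), hη, neg_one_mul]
  have hcard : (Fintype.card F : ℤ) = 6 * f + 1 := by
    have h1 := orderOf_generator hα
    have := Fintype.card_pos (α := F)
    omega
  obtain ⟨k, hk⟩ := odd_sum_quadraticChar_add_one hα hn (even_two_mul f)
  -- Cubing is three to one on nonzero elements and the sum over cubes is odd, so `cubicSum 1 ≡ 4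
  -- (mod 6)`; this fixes `s` modulo 3.
  have h1 : cubicSum (1 : F) = 1 + 3 * (2 * k + 1) := by
    rw [← hk, cubicSum, ← Finset.add_sum_erase _ _ (Finset.mem_univ (0 : F)),
      sum_erase_zero_pow hα hn (fun u => quadraticChar F (u + 1))]
    simp
  have hlin := sum_quadraticChar_mul_cubicSum hF
  rw [sum_eq_of_mul_cube_invariant hα hn (by simp)] at hlin
  swap
  · intro c
    rw [hcube, map_mul, map_pow, hη]
    ring
  have hsq := sum_cubicSum_sq hF hα hn
  rw [sum_eq_of_mul_cube_invariant hα hn (by rw [cubicSum_zero hF]; norm_num)] at hsq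
  swap
  · intro c
    rw [hcube, neg_sq]
  rw [map_one, hη, quadraticChar_sq_one' (Units.ne_zero α)] at hlin
  rw [hcard] at hsq
  have hfz : (2 * f : ℤ) ≠ 0 := by omega
  push_cast at hlin hsq
  have hlin' := (mul_eq_zero.1 hlin).resolve_left hfz
  have hsq' : cubicSum (1 : F) ^ 2 + cubicSum (α : F) ^ 2 + cubicSum ((α : F) ^ 2) ^ 2 =
      6 * (6 * f + 1) := by
    apply mul_left_cancel₀ hfz
    rw [hsq]
    ring
  generalize cubicSum (α : F) = b at *
  generalize cubicSum ((α : F) ^ 2) = c at *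
  rw [h1] at hlin' hsq'
  obtain rfl : b = 1 + 3 * (2 * k + 1) + c := by linarith
  -- Eliminating `b` leaves a binary form; completing the square gives `(c + (2 + 3 * k)) ^ 2 + 3 *
  -- (2 + 3 * k) ^ 2 = 3 * q`, so 3 divides `c + (2 + 3 * k)`.
  have e : c ^ 2 + (1 + 3 * (2 * k + 1)) * c + (1 + 3 * (2 * k + 1)) ^ 2 = 3 * (6 * f + 1) := by
    linarith
  have hw : ∃ w, c + (2 + 3 * k) = 3 * w := by
    have h3 : (3 : ℤ) ∣ (c + (2 + 3 * k)) ^ 2 :=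
      ⟨6 * f + 1 - (2 + 3 * k) ^ 2, by linear_combination e⟩
    exact Int.prime_three.dvd_of_dvd_pow h3
  obtain ⟨w, hw⟩ := hw
  refine ⟨-(2 + 3 * k), w, by rw [h1]; ring, ?_, ?_⟩
  · rw [Int.ModEq]
    omega
  · rw [hcard]
    obtain rfl : c = 3 * w - (2 + 3 * k) := by linarith
    have : (3 : ℤ) * (6 * f + 1) = 3 * ((-(2 + 3 * k)) ^ 2 + 3 * w ^ 2) := by
      rw [← e]; ring
    linarith

/-- Expand Euler's criterion `η z = z ^ (3 * f)` at `z = x ^ 3 + 1`; after summation over `x` only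
the exponent `q - 1 = 6 * f` survives. -/
lemma cast_cubicSum_one (hF : ringChar F ≠ 2) {f : ℕ} (hcard : Fintype.card F = 6 * f + 1) :
    ((cubicSum (1 : F) : ℤ) : F) = -((3 * f).choose (2 * f) : F) := by
  have hf0 : 0 < f := by
    have := Fintype.one_lt_card (α := F)
    omega
  have hsum : ∀ k ∈ Finset.range (3 * f + 1),
      ∑ x : F, (x ^ 3) ^ k = if k = 2 * f then -1 else 0 := by
    intro k hk
    rw [Finset.mem_range] at hk
    simp only [← pow_mul]
    rcases lt_trichotomy k (2 * f) with h | rfl | h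
    · rw [if_neg h.ne, FiniteField.sum_pow_lt_card_sub_one]
      omega
    · rw [if_pos rfl, ← Finset.add_sum_erase _ _ (Finset.mem_univ (0 : F)),
        zero_pow (by omega), Finset.sum_congr rfl (g := fun _ => (1 : F))]
      · rw [Finset.sum_const, Finset.card_erase_of_mem (Finset.mem_univ _), Finset.card_univ,
          nsmul_eq_mul, Nat.cast_sub (Fintype.card_pos (α := F)), FiniteField.cast_card_eq_zero]
        simp
      · intro x hx
        rw [show 3 * (2 * f) = Fintype.card F - 1 by omega,
          FiniteField.pow_card_sub_one_eq_one x (Finset.ne_of_mem_erase hx)]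
    -- Here `q - 1 < 3 * k`; `x ^ q = x` lowers the exponent by `q - 1` into the range where power
    -- sums vanish.
    · rw [if_neg h.ne', ← FiniteField.sum_pow_lt_card_sub_one F (3 * (k - 2 * f)) (by omega)]
      refine Finset.sum_congr rfl fun x _ => ?_
      rw [show 3 * k = Fintype.card F + (3 * (k - 2 * f) - 1) by omega, pow_add,
        FiniteField.pow_card, ← pow_succ']
      congr 1
      omega
  unfold cubicSum
  rw [Int.cast_sum]
  simp only [quadraticChar_eq_pow_of_char_ne_two' hF, add_pow, one_pow, mul_one]
  rw [show Fintype.card F / 2 = 3 * f by omega, Finset.sum_comm]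
  simp only [← Finset.sum_mul]
  rw [Finset.sum_congr rfl fun k hk => by rw [hsum k hk]]
  simp
  omega

end CharacterSums

/-! ### Identification of `s` and the shifted sums over classes. -/

section Evaluation

lemma charP_of_card_eq_pow {F : Type*} [Field F] [Fintype F] {p m : ℕ} (hp : p.Prime)
    (h : Fintype.card F = p ^ m) : CharP F p := by
  have h0 : (p : F) = 0 := by
    have : ((p ^ m : ℕ) : F) = 0 := by rw [← h, FiniteField.cast_card_eq_zero]
    rw [Nat.cast_pow] at this
    exact pow_eq_zero_iff (n := m) (by rintro rfl; simp at this) |>.1 this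
  have hd := ringChar.dvd h0
  rcases (Nat.dvd_prime hp).1 hd with h1 | h1
  · exact absurd h1 CharP.ringChar_ne_one
  · exact ringChar.of_eq h1

variable {F : Type*} [Field F] [Fintype F] [DecidableEq F]

/-- The cubic character sum yields the representation of `q` by `s ^ 2 + 3 * t ^ 2`. -/
lemma exists_isSexticRep {p m f : ℕ} (hp : p.Prime) (hp2 : p ≠ 2)
    (hqf : p ^ m = 6 * f + 1) (hF : Fintype.card F = p ^ m) {α : Fˣ}
    (hα : ∀ x : Fˣ, x ∈ Subgroup.zpowers α) :
    ∃ s t : ℤ, cubicSum (1 : F) = -2 * s ∧ IsSexticRep p m s t := by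
  have hchar := charP_of_card_eq_pow hp hF
  have hF2 : ringChar F ≠ 2 := by rwa [ringChar.eq F p]
  obtain ⟨s, t, h1, h2, h3⟩ := exists_cubicSum_one_eq hF2 hα (f := f) (by
    rw [orderOf_generator hα]
    omega)
  rw [hF] at h3
  push_cast at h3
  refine ⟨s, t, h1, h3, h2, fun h5 => ?_, fun h6 => ?_⟩
  · have hm : Even m := by
      by_contra hm
      rw [Nat.not_even_iff_odd] at hm
      obtain ⟨k, rfl⟩ := hm
      have e : p ^ (2 * k + 1) ≡ 5 [MOD 6] := by
        have h25 : p ^ 2 ≡ 1 [MOD 6] := (h5.pow 2).trans (by decide)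
        have := (h25.pow k).mul h5
        rwa [one_pow, one_mul, ← pow_mul, ← pow_succ] at this
      rw [hqf, Nat.ModEq] at e
      omega
    obtain ⟨k, rfl⟩ := hm
    rw [← two_mul] at h3
    exact eq_zero_of_pow_eq_sq_add_three_mul_sq hp h5 k h3
  -- If `p ∣ s`, then `cubicSum 1` would vanish in `F`, and so would the binomial coefficient.
  · have hps : ¬ (p : ℤ) ∣ s := by
      intro hd
      have hc : ((cubicSum (1 : F) : ℤ) : F) = 0 := by
        rw [CharP.intCast_eq_zero_iff F p, h1]
        exact hd.mul_left _
      rw [cast_cubicSum_one hF2 (hF.trans hqf), neg_eq_zero, CharP.cast_eq_zero_iff F p] at hc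
      exact not_dvd_choose_half_third hp h6 m f hqf hc
    have hcop : IsCoprime s ((p : ℤ) ^ m) :=
      (((Nat.prime_iff_prime_int.1 hp).irreducible.coprime_iff_not_dvd.2 hps).pow_left).symm
    have : IsCoprime s (t * (3 * t) + s * s) := by
      convert! hcop using 1
      rw [h3]
      ring
    exact (IsCoprime.add_mul_left_right_iff.1 this).of_mul_right_left

lemma quadraticChar_neg_one_eq_one {f : ℕ} (hF : ringChar F ≠ 2)
    (hcard : Fintype.card F = 6 * f + 1) (hf : Even f) : quadraticChar F (-1) = 1 := by
  rw [quadraticChar_neg_one hF]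
  apply ZMod.χ₄_nat_one_mod_four
  obtain ⟨k, rfl⟩ := hf
  omega

/-- On nonzero elements `1 + η` is twice the indicator of the squares. -/
lemma two_mul_sum_cyclotomicClass_two {α : Fˣ} (hα : ∀ x : Fˣ, x ∈ Subgroup.zpowers α)
    (h : F → ℤ) : 2 * ∑ u ∈ cyclotomicClass α 2 0, h u =
      ∑ x ∈ Finset.univ.erase 0, (1 + quadraticChar F x) * h x := by
  have hsub : cyclotomicClass α 2 0 = (Finset.univ.erase (0 : F)).filter
      (fun x => quadraticChar F x = 1) := by
    ext x
    rw [mem_cyclotomicClass_two_iff hα]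
    simp only [Finset.mem_filter, Finset.mem_erase, Finset.mem_univ, and_true]
    refine ⟨fun h => ⟨?_, h⟩, fun h => h.2⟩
    rintro rfl
    simp at h
  rw [hsub, Finset.sum_filter, Finset.mul_sum]
  refine Finset.sum_congr rfl fun x hx => ?_
  rcases quadraticChar_dichotomy (Finset.ne_of_mem_erase hx) with h | h <;> rw [h] <;> norm_num

/-- The left side is the sum of `η (x ^ 6 - 1)` over `x ≠ 0`. Regarding `x ^ 6` as the cube of a
square turns it into the sum of `(1 + η x) * η (x ^ 3 - 1)`, whose two halves both equal `cubicSum 1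
- 1`. -/
lemma sum_quadraticChar_sub_one_six {α : Fˣ} (hα : ∀ x : Fˣ, x ∈ Subgroup.zpowers α)
    {f : ℕ} (hF : ringChar F ≠ 2) (hcard : Fintype.card F = 6 * f + 1) (hf : Even f) :
    6 * ∑ u ∈ cyclotomicClass α 6 0, quadraticChar F (u - 1) = 2 * cubicSum (1 : F) - 2 := by
  have hord : orderOf α = 6 * f := by rw [orderOf_generator hα, hcard]; omega
  have hη := quadraticChar_neg_one_eq_one hF hcard hf
  have hneg : ∀ x : F, quadraticChar F (-x) = quadraticChar F x := fun x => by
    rw [← neg_one_mul, map_mul, hη, one_mul]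
  have hcub : cubicSum (1 : F) = ∑ x : F, quadraticChar F (x ^ 3 - 1) := by
    rw [cubicSum, ← Equiv.sum_comp (Equiv.neg F)]
    refine Finset.sum_congr rfl fun x _ => ?_
    rw [← hneg]
    congr 1
    simp only [Equiv.neg_apply]
    ring
  have hcub' : cubicSum (1 : F) = 1 + ∑ x ∈ Finset.univ.erase 0, quadraticChar F (x ^ 3 - 1) := by
    rw [hcub, ← Finset.add_sum_erase _ _ (Finset.mem_univ (0 : F))]
    simp [hη]
  have h6 := sum_erase_zero_pow hα hord.symm (fun u => quadraticChar F (u - 1))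
  have h2 := sum_erase_zero_pow hα (show 2 * (3 * f) = orderOf α by omega)
    (fun u => quadraticChar F (u ^ 3 - 1))
  rw [nsmul_eq_mul] at h6 h2
  push_cast at h6 h2
  have hhalf := two_mul_sum_cyclotomicClass_two hα fun x => quadraticChar F (x ^ 3 - 1)
  -- Inversion `x ↦ x⁻¹` absorbs the twist by `η x`, because `η (-1) = 1`.
  have hinv : ∑ x ∈ Finset.univ.erase (0 : F), quadraticChar F x * quadraticChar F (x ^ 3 - 1) =
      ∑ x ∈ Finset.univ.erase (0 : F), quadraticChar F (x ^ 3 - 1) := by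
    refine Finset.sum_nbij' (fun x => x⁻¹) (fun x => x⁻¹) ?_ ?_ ?_ ?_ ?_
    · intro x hx
      simpa using hx
    · intro x hx
      simpa using hx
    · intro x _
      exact inv_inv x
    · intro x _
      exact inv_inv x
    · intro x hx
      have hx0 : x ≠ 0 := Finset.ne_of_mem_erase hx
      have e : x * (x ^ 3 - 1) = (x ^ 2) ^ 2 * -((x⁻¹) ^ 3 - 1) := by
        field_simp
        ring
      rw [← map_mul, e, map_mul, quadraticChar_sq_one' (pow_ne_zero 2 hx0), hneg, one_mul]
  simp only [← pow_mul] at h2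
  rw [← h6]
  rw [show 2 * 3 = 6 from rfl] at h2
  rw [h2, hhalf]
  simp only [add_mul, one_mul, Finset.sum_add_distrib]
  rw [hinv]
  linarith

lemma sum_quadraticChar_sub_one_two {α : Fˣ} (hα : ∀ x : Fˣ, x ∈ Subgroup.zpowers α)
    {f : ℕ} (hF : ringChar F ≠ 2) (hcard : Fintype.card F = 6 * f + 1) (hf : Even f) :
    ∑ u ∈ cyclotomicClass α 2 0, quadraticChar F (u - 1) = -1 := by
  have hη := quadraticChar_neg_one_eq_one hF hcard hf
  have hhalf := two_mul_sum_cyclotomicClass_two hα fun x => quadraticChar F (x - 1)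
  have h0 : ∑ x ∈ Finset.univ.erase 0, (1 + quadraticChar F x) * quadraticChar F (x - 1) + 1 =
      ∑ x : F, (1 + quadraticChar F x) * quadraticChar F (x - 1) := by
    rw [← Finset.sum_erase_add _ _ (Finset.mem_univ (0 : F)), MulChar.map_zero, zero_sub, hη]
    norm_num only
  have h1 : ∑ x : F, quadraticChar F (x - 1) = 0 := by
    rw [← quadraticChar_sum_zero hF]
    exact Fintype.sum_equiv (Equiv.subRight 1) _ _ fun _ => rfl
  have h2 := sum_quadraticChar_mul_add hF (neg_ne_zero.2 (one_ne_zero' F))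
  simp only [← sub_eq_add_neg, map_mul] at h2
  simp only [add_mul, one_mul, Finset.sum_add_distrib] at hhalf h0
  linarith

end Evaluation

/-! ### Multiplicities of differences. -/

section Counting

lemma count_sum_map {ι β γ : Type*} [DecidableEq β] [DecidableEq γ] {K : Finset ι}
    {A : ι → Finset β} (hA : (K : Set ι).PairwiseDisjoint A) (g : β → γ) (d : γ) :
    Multiset.count d (∑ k ∈ K, (A k).val.map g) = ((K.biUnion A).filter fun z => g z = d).card := by
  rw [Multiset.count_sum', Finset.filter_biUnion, Finset.card_biUnion]
  · refine Finset.sum_congr rfl fun k _ => ?_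
    rw [Multiset.count_map, Finset.card_def, Finset.filter_val]
    simp only [eq_comm]
  · intro i hi j hj hij
    exact Finset.disjoint_filter_filter (hA hi hj hij)

variable {G : Type*} [AddGroup G] [DecidableEq G]

lemma count_allInt {m : ℕ} {D : Fin m → Finset G}
    (hD : Pairwise fun i j => Disjoint (D i) (D j)) (d : G) :
    Multiset.count d (allInt D) =
      ((Finset.univ.biUnion fun i => (D i).offDiag).filter fun z => z.1 - z.2 = d).card := by
  refine count_sum_map (fun i _ j _ hij => ?_) _ d
  rw [Function.onFun, Finset.disjoint_left]
  intro z hz hz'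
  exact Finset.disjoint_left.1 (hD hij) (Finset.mem_offDiag.1 hz).1 (Finset.mem_offDiag.1 hz').1

lemma count_allExt {m : ℕ} {D : Fin m → Finset G}
    (hD : Pairwise fun i j => Disjoint (D i) (D j)) (d : G) :
    Multiset.count d (allExt D) =
      (((Finset.univ : Finset (Fin m)).offDiag.biUnion fun k => D k.1 ×ˢ D k.2).filter
        fun z => z.1 - z.2 = d).card := by
  refine count_sum_map (fun i _ j _ hij => ?_) _ d
  rw [Function.onFun, Finset.disjoint_left]
  intro z hz hz'
  rw [Finset.mem_product] at hz hz'
  apply hij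
  ext1
  · by_contra hne
    exact Finset.disjoint_left.1 (hD hne) hz.1 hz'.1
  · by_contra hne
    exact Finset.disjoint_left.1 (hD hne) hz.2 hz'.2

lemma ne_zero_of_mem_squaresFamily {F : Type*} [Field F] [Fintype F] {α : Fˣ} {i : Fin 3}
    {x : F} (hx : x ∈ squaresFamily α i) : x ≠ 0 :=
  ne_zero_of_mem_cyclotomicClass hx

lemma zpow_mem_squaresFamily {F : Type*} [Field F] [Fintype F] {α : Fˣ} {f : ℕ}
    (hf : orderOf α = 6 * f) (i : Fin 3) (k : ℤ) :
    ((α ^ k : Fˣ) : F) ∈ squaresFamily α i ↔ (6 : ℤ) ∣ k - 2 * (i : ℕ) := by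
  rw [squaresFamily, zpow_mem_cyclotomicClass (Dvd.intro f hf.symm)]
  push_cast
  rfl

lemma squaresFamily_disjoint {F : Type*} [Field F] [Fintype F] {α : Fˣ} {f : ℕ}
    (hα : ∀ x : Fˣ, x ∈ Subgroup.zpowers α) (hf : orderOf α = 6 * f) :
    Pairwise fun i j => Disjoint (squaresFamily α i) (squaresFamily α j) := by
  intro i j hij
  rw [Finset.disjoint_left]
  intro x hx hx'
  obtain ⟨k, rfl⟩ := exists_zpow_eq hα (ne_zero_of_mem_squaresFamily hx)
  rw [zpow_mem_squaresFamily hf] at hx hx'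
  exact hij (by ext; omega)

variable {F : Type*} [Field F] [Fintype F] [DecidableEq F]

/-- The number of `u ∈ H` for which `u - 1` has quadratic character `ε`. -/
def shiftCount (H : Finset F) (ε : ℤ) : ℕ := (H.filter fun u => quadraticChar F (u - 1) = ε).card

lemma shiftCount_add (H : Finset F) :
    shiftCount H 1 + shiftCount H (-1) = (H.erase 1).card := by
  rw [shiftCount, shiftCount, ← Finset.card_union_of_disjoint]
  · congr 1
    ext u
    simp only [Finset.mem_union, Finset.mem_filter, Finset.mem_erase]
    constructor
    · rintro (⟨h, h'⟩ | ⟨h, h'⟩) <;> refine ⟨?_, h⟩ <;> rintro rfl <;> simp at h'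
    · rintro ⟨h, h'⟩
      rcases quadraticChar_dichotomy (sub_ne_zero.2 h) with h1 | h1
      · exact Or.inl ⟨h', h1⟩
      · exact Or.inr ⟨h', h1⟩
  · rw [Finset.disjoint_left]
    intro u hu hu'
    have h1 := (Finset.mem_filter.1 hu).2
    rw [(Finset.mem_filter.1 hu').2] at h1
    norm_num at h1

lemma shiftCount_sub (H : Finset F) :
    (shiftCount H 1 : ℤ) - shiftCount H (-1) = ∑ u ∈ H, quadraticChar F (u - 1) := by
  rw [shiftCount, shiftCount, Finset.card_filter, Finset.card_filter]
  push_cast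
  rw [← Finset.sum_sub_distrib]
  refine Finset.sum_congr rfl fun u _ => ?_
  rcases eq_or_ne (u - 1) 0 with h | h
  · simp [h]
  · rcases quadraticChar_dichotomy h with h1 | h1 <;> rw [h1] <;> norm_num

/-- Pairs `(x, y)` with `y` a nonzero square, `x / y ∈ H` and given difference. -/
lemma card_filter_sub_eq {P : Finset (F × F)} {H : Finset F}
    (hP : ∀ x y : F, x ≠ y → ((x, y) ∈ P ↔ quadraticChar F y = 1 ∧ x / y ∈ H)) {d : F}
    (hd : d ≠ 0) :
    (P.filter fun z => z.1 - z.2 = d).card = shiftCount H (quadraticChar F d) := by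
  have hη0 : ∀ x : F, quadraticChar F x = 1 → x ≠ 0 := by
    rintro x hx rfl
    simp at hx
  -- The quotient `u = x / y` determines the pair, since `y * (u - 1) = d`.
  refine Finset.card_nbij' (fun z => z.1 / z.2) (fun u => (u * (d / (u - 1)), d / (u - 1)))
    ?_ ?_ ?_ ?_
  · rintro ⟨x, y⟩ hz
    obtain ⟨h, rfl⟩ := Finset.mem_filter.1 hz
    obtain ⟨hy, hH⟩ := (hP x y (sub_ne_zero.1 hd)).1 h
    have hy0 := hη0 y hy
    refine Finset.mem_filter.2 ⟨hH, ?_⟩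
    have e : x - y = y * (x / y - 1) := by field_simp
    change quadraticChar F (x / y - 1) = quadraticChar F (x - y)
    rw [e, map_mul, hy, one_mul]
  · intro u hu
    obtain ⟨hH, h⟩ := Finset.mem_filter.1 hu
    have hu1 : u - 1 ≠ 0 := by
      intro h0
      rw [h0, MulChar.map_zero, eq_comm, quadraticChar_eq_zero_iff] at h
      exact hd h
    have hsub : u * (d / (u - 1)) - d / (u - 1) = d := by field_simp
    refine Finset.mem_filter.2 ⟨?_, hsub⟩
    rw [hP _ _ (sub_ne_zero.1 (by rw [hsub]; exact hd))]
    refine ⟨?_, ?_⟩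
    · have e : d * (u - 1) = d / (u - 1) * (u - 1) ^ 2 := by field_simp
      have e' := congrArg (quadraticChar F) e
      rw [map_mul, map_mul, h, quadraticChar_sq_one' hu1, mul_one, ← sq,
        quadraticChar_sq_one hd] at e'
      exact e'.symm
    · rwa [mul_div_cancel_right₀ _ (div_ne_zero hd hu1)]
  · rintro ⟨x, y⟩ hz
    obtain ⟨h, rfl⟩ := Finset.mem_filter.1 hz
    have hxy := sub_ne_zero.1 hd
    obtain ⟨hy, hH⟩ := (hP x y hxy).1 h
    have hy0 := hη0 y hy
    have e : (x - y) / (x / y - 1) = y := by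
      have : x / y - 1 = (x - y) / y := by field_simp
      rw [this, div_div_cancel₀ hd]
    change (x / y * ((x - y) / (x / y - 1)), (x - y) / (x / y - 1)) = (x, y)
    rw [e, div_mul_cancel₀ _ hy0]
  · intro u hu
    obtain ⟨hH, h⟩ := Finset.mem_filter.1 hu
    have hu1 : u - 1 ≠ 0 := by
      intro h0
      rw [h0, MulChar.map_zero, eq_comm, quadraticChar_eq_zero_iff] at h
      exact hd h
    exact mul_div_cancel_right₀ _ (div_ne_zero hd hu1)

variable {α : Fˣ} {f : ℕ}

lemma mem_support_squaresFamily (hα : ∀ x : Fˣ, x ∈ Subgroup.zpowers α) (hf : orderOf α = 6 * f)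
    {x : F} : x ∈ support (squaresFamily α) ↔ quadraticChar F x = 1 := by
  simp only [support, Finset.mem_biUnion, Finset.mem_univ, true_and,
    ← mem_cyclotomicClass_two_iff hα]
  constructor
  · rintro ⟨i, hx⟩
    obtain ⟨k, rfl⟩ := exists_zpow_eq hα (ne_zero_of_mem_squaresFamily hx)
    rw [zpow_mem_squaresFamily hf] at hx
    rw [zpow_mem_cyclotomicClass (by omega)]
    push_cast
    omega
  · intro hx
    obtain ⟨k, rfl⟩ := exists_zpow_eq hα (ne_zero_of_mem_cyclotomicClass hx)
    rw [zpow_mem_cyclotomicClass (by omega)] at hx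
    push_cast at hx
    -- For even `k`, `α ^ k` lies in the class whose exponent `2 * i` is `k` modulo 6.
    refine ⟨⟨(k / 2 % 3).toNat, by omega⟩, (zpow_mem_squaresFamily hf _ _).2 ?_⟩
    simp only
    omega

lemma count_allInt_squaresFamily (hα : ∀ x : Fˣ, x ∈ Subgroup.zpowers α)
    (hf : orderOf α = 6 * f) {d : F} (hd : d ≠ 0) :
    Multiset.count d (allInt (squaresFamily α)) =
      shiftCount (cyclotomicClass α 6 0) (quadraticChar F d) := by
  rw [count_allInt (squaresFamily_disjoint hα hf)]
  refine card_filter_sub_eq (fun x y hxy => ?_) hd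
  rw [← mem_support_squaresFamily hα hf, support]
  simp only [Finset.mem_biUnion, Finset.mem_univ, true_and, Finset.mem_offDiag]
  constructor
  · rintro ⟨i, hx, hy, -⟩
    refine ⟨⟨i, hy⟩, ?_⟩
    obtain ⟨k, rfl⟩ := exists_zpow_eq hα (ne_zero_of_mem_squaresFamily hx)
    obtain ⟨l, rfl⟩ := exists_zpow_eq hα (ne_zero_of_mem_squaresFamily hy)
    rw [zpow_mem_squaresFamily hf] at hx hy
    rw [← Units.val_div_eq_div_val, div_eq_mul_inv, ← zpow_sub,
      zpow_mem_cyclotomicClass (Dvd.intro f hf.symm)]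
    push_cast
    omega
  · rintro ⟨⟨i, hy⟩, h⟩
    have hy0 := ne_zero_of_mem_squaresFamily hy
    have hx0 : x ≠ 0 := by
      rintro rfl
      simpa using ne_zero_of_mem_cyclotomicClass h
    refine ⟨i, ?_, hy, hxy⟩
    obtain ⟨k, rfl⟩ := exists_zpow_eq hα hx0
    obtain ⟨l, rfl⟩ := exists_zpow_eq hα hy0
    rw [← Units.val_div_eq_div_val, div_eq_mul_inv, ← zpow_sub,
      zpow_mem_cyclotomicClass (Dvd.intro f hf.symm)] at h
    rw [zpow_mem_squaresFamily hf] at hy ⊢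
    push_cast at h
    omega

lemma count_allExt_squaresFamily (hα : ∀ x : Fˣ, x ∈ Subgroup.zpowers α)
    (hf : orderOf α = 6 * f) {d : F} (hd : d ≠ 0) :
    Multiset.count d (allExt (squaresFamily α)) =
      shiftCount (cyclotomicClass α 2 0 \ cyclotomicClass α 6 0) (quadraticChar F d) := by
  rw [count_allExt (squaresFamily_disjoint hα hf)]
  refine card_filter_sub_eq (fun x y hxy => ?_) hd
  rw [← mem_support_squaresFamily hα hf, support]
  simp only [Finset.mem_biUnion, Finset.mem_univ, true_and, Finset.mem_offDiag, Finset.mem_product,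
    Prod.exists, Finset.mem_sdiff]
  constructor
  · rintro ⟨i, j, hij, hx, hy⟩
    refine ⟨⟨j, hy⟩, ?_⟩
    obtain ⟨k, rfl⟩ := exists_zpow_eq hα (ne_zero_of_mem_squaresFamily hx)
    obtain ⟨l, rfl⟩ := exists_zpow_eq hα (ne_zero_of_mem_squaresFamily hy)
    rw [zpow_mem_squaresFamily hf] at hx hy
    rw [← Units.val_div_eq_div_val, div_eq_mul_inv, ← zpow_sub,
      zpow_mem_cyclotomicClass (by omega),
      zpow_mem_cyclotomicClass (Dvd.intro f hf.symm)]
    rw [Ne, Fin.ext_iff] at hij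
    push_cast
    omega
  · rintro ⟨⟨j, hy⟩, h, h'⟩
    have hy0 := ne_zero_of_mem_squaresFamily hy
    have hx0 : x ≠ 0 := by
      rintro rfl
      simpa using ne_zero_of_mem_cyclotomicClass h
    obtain ⟨k, rfl⟩ := exists_zpow_eq hα hx0
    obtain ⟨l, rfl⟩ := exists_zpow_eq hα hy0
    rw [← Units.val_div_eq_div_val, div_eq_mul_inv, ← zpow_sub,
      zpow_mem_cyclotomicClass (by omega)] at h
    rw [← Units.val_div_eq_div_val, div_eq_mul_inv, ← zpow_sub,
      zpow_mem_cyclotomicClass (Dvd.intro f hf.symm)] at h'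
    rw [zpow_mem_squaresFamily hf] at hy
    push_cast at h h'
    refine ⟨⟨(k / 2 % 3).toNat, by omega⟩, j, ?_, (zpow_mem_squaresFamily hf _ _).2 ?_,
      (zpow_mem_squaresFamily hf _ _).2 hy⟩
    · rw [Ne, Fin.ext_iff]
      simp only
      omega
    · simp only
      omega

lemma count_zero_allInt {m : ℕ} (D : Fin m → Finset G) : Multiset.count 0 (allInt D) = 0 := by
  rw [allInt, Multiset.count_sum', Finset.sum_eq_zero]
  intro i _
  rw [Multiset.count_eq_zero, intDiff, Multiset.mem_map]
  rintro ⟨z, hz, h⟩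
  exact (Finset.mem_offDiag.1 hz).2.2 (sub_eq_zero.1 h)

lemma count_zero_allExt {m : ℕ} {D : Fin m → Finset G}
    (hD : Pairwise fun i j => Disjoint (D i) (D j)) : Multiset.count 0 (allExt D) = 0 := by
  rw [allExt, Multiset.count_sum', Finset.sum_eq_zero]
  intro i hi
  rw [Multiset.count_eq_zero, extDiff, Multiset.mem_map]
  rintro ⟨z, hz, h⟩
  obtain ⟨h1, h2⟩ := Finset.mem_product.1 hz
  rw [sub_eq_zero.1 h] at h1
  exact Finset.disjoint_left.1 (hD (Finset.mem_offDiag.1 hi).2.2) h1 h2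

/-- A multiset of nonzero differences whose multiplicities depend only on the quadratic
character. -/
lemma eq_smul_support_add_smul (hα : ∀ x : Fˣ, x ∈ Subgroup.zpowers α) (hf : orderOf α = 6 * f)
    {M : Multiset F} {H : Finset F} (h0 : Multiset.count 0 M = 0)
    (hM : ∀ d : F, d ≠ 0 → Multiset.count d M = shiftCount H (quadraticChar F d)) :
    M = shiftCount H 1 • (support (squaresFamily α)).val +
      shiftCount H (-1) • (nonzero F \ support (squaresFamily α)).val := by
  ext d
  have hcount : ∀ S : Finset F, Multiset.count d S.val = if d ∈ S then 1 else 0 := fun S =>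
    Multiset.count_eq_of_nodup S.nodup
  rw [Multiset.count_add, Multiset.count_nsmul, Multiset.count_nsmul, hcount, hcount]
  simp only [Finset.mem_sdiff, mem_support_squaresFamily hα hf, nonzero, Finset.mem_erase]
  rcases eq_or_ne d 0 with rfl | hd
  · rw [h0]
    simp
  · rw [hM d hd]
    rcases quadraticChar_dichotomy hd with h | h
    · simp [h]
    · rw [h]
      norm_num [hd]

end Counting

end DiffFamily

/-! ### Solving for the parameters. -/

theorem mainTheorem9 {F : Type*} [Field F] [Fintype F] [DecidableEq F]
    (q p m f : ℕ) (hp : p.Prime) (hqp : q = p ^ m) (hqf : q = 6 * f + 1) (hf : Even f)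
    (hF : Fintype.card F = q)
    (α : Fˣ) (hα : ∀ x : Fˣ, x ∈ Subgroup.zpowers α) :
    (∃! s : ℤ, ∃ t : ℤ, DiffFamily.IsSexticRep p m s t) ∧
    ∀ s t : ℤ, DiffFamily.IsSexticRep p m s t →
      (s ≠ 1 →
        (∃ lam mu : ℕ, (lam : ℚ) = ((q : ℚ) - 9 - 4 * s) / 12 ∧
          (mu : ℚ) = ((q : ℚ) - 5 + 4 * s) / 12 ∧
          DiffFamily.IsProperDPDF q 3 ((q - 1) / 6) lam mu (DiffFamily.squaresFamily α)) ∧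
        (∃ lam mu : ℕ, (lam : ℚ) = ((q : ℚ) - 3 + 2 * s) / 6 ∧
          (mu : ℚ) = ((q : ℚ) + 1 - 2 * s) / 6 ∧
          DiffFamily.IsProperEPDF q 3 ((q - 1) / 6) lam mu (DiffFamily.squaresFamily α))) ∧
      (s = 1 →
        (∃ lam mu : ℕ, (lam : ℚ) = ((q : ℚ) - 13) / 12 ∧
          (mu : ℚ) = ((q : ℚ) - 1) / 12 ∧
          DiffFamily.IsProperDPDF q 3 ((q - 1) / 6) lam mu (DiffFamily.squaresFamily α)) ∧
        DiffFamily.IsEDF q 3 ((q - 1) / 6) ((q - 1) / 6) (DiffFamily.squaresFamily α)) := by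
  have hcard : Fintype.card F = 6 * f + 1 := hF.trans hqf
  have hf0 : 0 < f := by
    have := Fintype.one_lt_card (α := F)
    omega
  have hm : m ≠ 0 := by
    rintro rfl
    rw [pow_zero] at hqp
    omega
  have hndvd : ∀ l, l ∣ 6 → l ≠ 1 → p ≠ l := by
    rintro l hl hl1 rfl
    have h1 : p ∣ 6 * f + 1 := by rw [← hqf, hqp]; exact dvd_pow_self p hm
    exact hl1 (Nat.dvd_one.1 ((Nat.dvd_add_right (hl.mul_right f)).1 h1))
  have hp2 : p ≠ 2 := hndvd 2 (by decide) (by decide)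
  have hp3 : p ≠ 3 := hndvd 3 (by decide) (by decide)
  have hord : orderOf α = 6 * f := by rw [DiffFamily.orderOf_generator hα, hcard]; omega
  have hchar := DiffFamily.charP_of_card_eq_pow hp (hF.trans hqp)
  have hF2 : ringChar F ≠ 2 := by rwa [ringChar.eq F p]
  obtain ⟨s₀, t₀, hs₀, hrep⟩ :=
    DiffFamily.exists_isSexticRep hp hp2 (hqp ▸ hqf) (hF.trans hqp) hα
  refine ⟨⟨s₀, ⟨t₀, hrep⟩, fun s ⟨t, h⟩ => h.unique hp hp2 hp3 hrep⟩, fun s t hst => ?_⟩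
  obtain rfl : s = s₀ := hst.unique hp hp2 hp3 hrep
  set C := DiffFamily.cyclotomicClass α 6 0 with hC
  set B := DiffFamily.cyclotomicClass α 2 0 with hB
  have hCB : C ⊆ B := by
    intro x hx
    obtain ⟨k, rfl⟩ := DiffFamily.exists_zpow_eq hα (DiffFamily.ne_zero_of_mem_cyclotomicClass hx)
    rw [hC, DiffFamily.zpow_mem_cyclotomicClass (Dvd.intro f hord.symm)] at hx
    rw [hB, DiffFamily.zpow_mem_cyclotomicClass (by omega)]
    push_cast at hx ⊢
    omega
  have h1C : (1 : F) ∈ C := by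
    simpa using DiffFamily.pow_mem_cyclotomicClass_zero hα 6 (one_ne_zero' F)
  have hcardC : C.card = f := DiffFamily.card_cyclotomicClass 0 hord.symm
  have hcardB : B.card = 3 * f := DiffFamily.card_cyclotomicClass 0 (by omega)
  have hsumC := DiffFamily.sum_quadraticChar_sub_one_six hα hF2 hcard hf
  have hsumB := DiffFamily.sum_quadraticChar_sub_one_two hα hF2 hcard hf
  rw [hs₀, ← hC] at hsumC
  rw [← hB, ← Finset.sum_sdiff hCB] at hsumB
  have iadd := DiffFamily.shiftCount_add C
  have isub := DiffFamily.shiftCount_sub C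
  have eadd := DiffFamily.shiftCount_add (B \ C)
  have esub := DiffFamily.shiftCount_sub (B \ C)
  -- The element `u = 1`, where `η (u - 1) = 0`, lies in `C` but not in `B \ C`: the totals are `f -
  -- 1` and `2 * f`.
  rw [Finset.card_erase_of_mem h1C, hcardC] at iadd
  rw [Finset.erase_eq_of_notMem (by simp [h1C]), Finset.card_sdiff_of_subset hCB, hcardB,
    hcardC] at eadd
  have hdisj := DiffFamily.squaresFamily_disjoint hα hord
  have hfam : DiffFamily.IsDisjointFamily q 3 ((q - 1) / 6) (DiffFamily.squaresFamily α) :=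
    ⟨hF, fun i => (DiffFamily.card_cyclotomicClass _ hord.symm).trans (by omega), hdisj⟩
  have hz : ∀ i, (0 : F) ∉ DiffFamily.squaresFamily α i := fun i h =>
    DiffFamily.ne_zero_of_mem_squaresFamily h rfl
  have hint := DiffFamily.eq_smul_support_add_smul hα hord
    (DiffFamily.count_zero_allInt (DiffFamily.squaresFamily α))
    (fun d hd => DiffFamily.count_allInt_squaresFamily hα hord hd)
  have hext := DiffFamily.eq_smul_support_add_smul hα hord
    (DiffFamily.count_zero_allExt hdisj)
    (fun d hd => DiffFamily.count_allExt_squaresFamily hα hord hd)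
  rw [← hC] at hint
  rw [← hC, ← hB] at hext
  generalize DiffFamily.shiftCount C 1 = a at *
  generalize DiffFamily.shiftCount C (-1) = b at *
  generalize DiffFamily.shiftCount (B \ C) 1 = c at *
  generalize DiffFamily.shiftCount (B \ C) (-1) = d at *
  -- The systems are `a + b = f - 1`, `3 * (a - b) = -(2 * s + 1)` and `c + d = 2 * f`, `3 * (c - d)
  -- = 2 * s - 2`. Hence `a ≠ b` always, while `c = d` exactly when `s = 1`.
  have ha : (12 * a : ℤ) = q - 9 - 4 * s := by omega
  have hb : (12 * b : ℤ) = q - 5 + 4 * s := by omega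
  have hc : (6 * c : ℤ) = q - 3 + 2 * s := by omega
  have hd : (6 * d : ℤ) = q + 1 - 2 * s := by omega
  have ha' : (12 * a : ℚ) = q - 9 - 4 * s := by exact_mod_cast ha
  have hb' : (12 * b : ℚ) = q - 5 + 4 * s := by exact_mod_cast hb
  have hc' : (6 * c : ℚ) = q - 3 + 2 * s := by exact_mod_cast hc
  have hd' : (6 * d : ℚ) = q + 1 - 2 * s := by exact_mod_cast hd
  refine ⟨fun hs => ⟨⟨a, b, by linarith, by linarith, ⟨hfam, hz, hint⟩, by omega⟩,
    ⟨c, d, by linarith, by linarith, ⟨hfam, hz, hext⟩, by omega⟩⟩, ?_⟩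
  rintro rfl
  push_cast at ha' hb'
  refine ⟨⟨a, b, by linarith, by linarith, ⟨hfam, hz, hint⟩, by omega⟩, hfam, ?_⟩
  obtain rfl : c = (q - 1) / 6 := by omega
  obtain rfl : d = (q - 1) / 6 := by omega
  rw [hext, ← nsmul_add]
  congr 1
  rw [Finset.sdiff_val, add_tsub_cancel_of_le]
  rw [Finset.val_le_iff]
  intro x hx
  rw [DiffFamily.nonzero, Finset.mem_erase]
  refine ⟨?_, Finset.mem_univ x⟩
  rintro rfl
  simp [DiffFamily.mem_support_squaresFamily hα hord] at hx
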